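/- Let $r>0$ and let $K\ge 0$ be an integer. A $\Delta$-domain at $r$ is a set $\{x\in\mathbb C: |x|<R,\ x\ne r,\ |\arg(x-r)|>\varphi\}$ with $R>r$ and $0<\varphi<\pi/2$; $\sqrt{\cdot}$ denotes the principal branch. Suppose $H_0$ is analytic in a $\Delta$-domain $D$ at $r$ and $$H_0(x)=a_0-c_0\sqrt{1-x/r}+O(1-x/r)\qquad (x\to r,\ x\in D),$$ with $a_0,c_0\in\mathbb C$, $c_0\neq 0$. Let $\Psi(x,v)$ be analytic in a neighbourhood of the points $(r,a_k)$, $0\le k\le K$, where $a_{k+1}=\Psi(r,a_k)$ for $0\le k\le K-1$, and assume $\partial_v\Psi(r,a_k)\neq 0$ for $0\le k\le K-1$. Define $H_{k+1}(x)=\Psi(x,H_k(x))$ for $0\le k\le K-1$, where these compositions are assumed to make sense on the closed disc $|x|\le r$, in the sense that $\Psi$ is analytic also in a neighbourhood of each point $(x,H_k(x))$ with $|x|\le r$, $x\ne r$, $0\le k\le K-1$. Then, with $c_{k+1}=c_k\,\partial_v\Psi(r,a_k)$ for $0\le k\le K-1$, one has $$c_k=c_0\prod_{j=0}^{k-1}\partial_v\Psi(r,a_j)\ne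 0\qquad(1\le k\le K),$$ and for each $k\in\{0,\dots,K\}$ the function $H_k$ is analytic in a $\Delta$-domain $D_k\subseteq D$ at $r$ and $$H_k(x)=a_k-c_k\sqrt{1-x/r}+O(1-x/r)\qquad (x\to r,\ x\in D_k).$$ Consequently, for each $k\in\{0,\dots,K\}$, $$[x^n]H_k(x)\sim \frac{c_k}{2\sqrt{\pi}}\,r^{-n}n^{-3/2}\qquad(n\to\infty).$$ -/

import Mathlib

open Filter Topology Asymptotics

/-- The open disc of radius `R` about the origin, indented at `r`: the points `x ≠ r` with
`|x| < R` and `|arg (x - r)| > φ`. -/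
def deltaRegion (r φ R : ℝ) : Set ℂ :=
  {x : ℂ | ‖x‖ < R ∧ x ≠ (r : ℂ) ∧ φ < |Complex.arg (x - (r : ℂ))|}

/-- `D` is a `Δ`-domain at the point `r > 0`. -/
def IsDeltaDomain (r : ℝ) (D : Set ℂ) : Prop :=
  ∃ φ R : ℝ, 0 < φ ∧ φ < Real.pi / 2 ∧ r < R ∧ D = deltaRegion r φ R

/-- `f x = a - c √(1 - x/r) + O(1 - x/r)` as `x → r` inside `D`. The principal branch of the
square root is used; if `D` is a `Δ`-domain at `r`, then `1 - x/r` avoids `(-∞, 0]` on `D`. -/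
def HasSqrtExpansion (f : ℂ → ℂ) (r : ℝ) (D : Set ℂ) (a c : ℂ) : Prop :=
  (fun x : ℂ => f x - (a - c * (1 - x / (r : ℂ)) ^ (1 / 2 : ℂ)))
    =O[𝓝[D] (r : ℂ)] (fun x : ℂ => 1 - x / (r : ℂ))

/-- The coefficient `[x^n] f` of the Taylor series of `f` at the origin. -/
noncomputable def taylorCoeffZero (f : ℂ → ℂ) (n : ℕ) : ℂ :=
  iteratedDeriv n f 0 / (n.factorial : ℂ)

/-- The partial derivative `∂_v Ψ (x, v)` in the second variable. -/
noncomputable def partialV (Ψ : ℂ × ℂ → ℂ) (x v : ℂ) : ℂ :=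
  deriv (fun w : ℂ => Ψ (x, w)) v

/-! The expansion propagates because `Ψ` is linear in `v` near `(r, a_k)` up to an error O(|x - r| +
|v - a_k|²), and |H_k - a_k|² = O(1 - x/r) (`HasSqrtExpansion.comp_analyticAt`). Analyticity
propagates because the set where the composition is analytic contains the closed disc minus `r` and
a neighbourhood of `r` in the domain, hence a smaller Δ-domain (`IsDeltaDomain.exists_subset`).

For the coefficients write f = a - c√(1 - x/r) + g with g = O(1 - x/r). The square root is explicit
and Euler's limit for Γ(-1/2) gives its asymptotics. No Hankel contour is needed for g: Cauchy
estimates give g''' = O(|x - r|⁻²), whose mean on a circle |x| = ρ < r is a Poisson integral of size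
1/(r² - ρ²). Taking r - ρ of order r/n yields [xⁿ]g = O(r⁻ⁿ n⁻²) = o(r⁻ⁿ n^(-3/2)). -/

/-! ### Geometry of Δ-domains. -/

/-- Trades the discontinuous `arg` for strict inequalities between continuous functions. -/
theorem mem_deltaRegion_iff {r φ R : ℝ} (h0 : 0 ≤ φ) (hπ : φ ≤ Real.pi) {x : ℂ} :
    x ∈ deltaRegion r φ R ↔ ‖x‖ < R ∧ (x - r).re < ‖x - r‖ * Real.cos φ := by
  unfold deltaRegion
  simp only [Set.mem_ofPred_eq]
  refine and_congr_right fun _ => ?_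
  rw [← Complex.norm_mul_cos_arg (x - r), ← Real.cos_abs (Complex.arg _)]
  by_cases hx : x = r
  · simp [hx]
  · have hpos : 0 < ‖x - (r : ℂ)‖ := norm_pos_iff.2 (sub_ne_zero.2 hx)
    rw [mul_lt_mul_iff_right₀ hpos]
    constructor
    · rintro ⟨_, h⟩
      exact Real.cos_lt_cos_of_nonneg_of_le_pi h0 (Complex.abs_arg_le_pi _) h
    · intro h
      refine ⟨hx, ?_⟩
      by_contra! h'
      exact absurd (Real.cos_le_cos_of_nonneg_of_le_pi (abs_nonneg _) hπ h') (not_le.2 h)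

theorem re_sub_neg_of_norm_le {r : ℝ} (hr : 0 < r) {x : ℂ} (hx : ‖x‖ ≤ r) (hne : x ≠ r) :
    (x - r).re < 0 := by
  by_contra! h
  simp only [Complex.sub_re, Complex.ofReal_re, sub_nonneg] at h
  have h2 := Complex.sq_norm x
  rw [Complex.normSq_apply] at h2
  have h3 : ‖x‖ ^ 2 ≤ r ^ 2 := pow_le_pow_left₀ (norm_nonneg _) hx 2
  have him : x.im = 0 := by nlinarith [mul_self_nonneg x.im, mul_self_nonneg (x.re - r)]
  have hre : x.re = r := by rw [him] at h2; nlinarith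
  exact hne (Complex.ext (by simpa using hre) (by simpa using him))

theorem IsDeltaDomain.isOpen {r : ℝ} {D : Set ℂ} (hD : IsDeltaDomain r D) : IsOpen D := by
  obtain ⟨φ, R, h0, h1, -, rfl⟩ := hD
  have : deltaRegion r φ R = {x : ℂ | ‖x‖ < R} ∩ {x : ℂ | (x - r).re < ‖x - r‖ * Real.cos φ} := by
    ext x
    exact mem_deltaRegion_iff h0.le (by linarith [Real.pi_pos])
  rw [this]
  exact (isOpen_lt (by fun_prop) (by fun_prop)).inter
    (isOpen_lt (Complex.continuous_re.comp (by fun_prop)) (by fun_prop))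

theorem IsDeltaDomain.mem_of_norm_le {r : ℝ} (hr : 0 < r) {D : Set ℂ} (hD : IsDeltaDomain r D)
    {x : ℂ} (hx : ‖x‖ ≤ r) (hne : x ≠ r) : x ∈ D := by
  obtain ⟨φ, R, h0, h1, hR, rfl⟩ := hD
  rw [mem_deltaRegion_iff h0.le (by linarith [Real.pi_pos])]
  refine ⟨by linarith, (re_sub_neg_of_norm_le hr hx hne).trans_le ?_⟩
  exact mul_nonneg (norm_nonneg _) (Real.cos_nonneg_of_neg_pi_div_two_le_of_le (by linarith) h1.le)

theorem IsDeltaDomain.zero_mem {r : ℝ} (hr : 0 < r) {D : Set ℂ} (hD : IsDeltaDomain r D) :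
    (0 : ℂ) ∈ D :=
  hD.mem_of_norm_le hr (by simpa using hr.le) (by exact_mod_cast hr.ne)

theorem IsDeltaDomain.one_sub_div_mem_slitPlane {r : ℝ} (hr : 0 < r) {D : Set ℂ}
    (hD : IsDeltaDomain r D) {x : ℂ} (hx : x ∈ D) : 1 - x / r ∈ Complex.slitPlane := by
  obtain ⟨φ, R, h0, h1, hR, rfl⟩ := hD
  rw [mem_deltaRegion_iff h0.le (by linarith [Real.pi_pos])] at hx
  have hc : 1 - x / r = ((r⁻¹ : ℝ) : ℂ) * -(x - r) := by
    have : (r : ℂ) ≠ 0 := by exact_mod_cast hr.ne'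
    push_cast
    field_simp
    ring
  rw [Complex.mem_slitPlane_iff_not_le_zero]
  intro hle
  rw [Complex.le_def] at hle
  obtain ⟨hre, him⟩ := hle
  rw [hc, Complex.re_ofReal_mul] at hre
  rw [hc, Complex.im_ofReal_mul] at him
  have hri : 0 < r⁻¹ := inv_pos.2 hr
  have hre' : 0 ≤ (x - r).re := by
    simp only [Complex.neg_re, Complex.zero_re] at hre
    nlinarith
  have him' : (x - r).im = 0 := by
    simp only [Complex.neg_im, Complex.zero_im] at him
    simpa [hri.ne'] using him
  have hn : ‖x - r‖ = (x - r).re := by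
    have : x - r = (((x - r).re : ℝ) : ℂ) := Complex.ext (by simp) (by simpa using him')
    rw [this, Complex.norm_real, Complex.ofReal_re, Real.norm_of_nonneg hre']
  have := Real.cos_le_one φ
  nlinarith [hx.2]

/-- The angle is kept and only the radius shrinks: away from `r` the closed disc is compact, so `U`
contains a uniform thickening of it. -/
theorem IsDeltaDomain.exists_subset {r : ℝ} (hr : 0 < r) {D U : Set ℂ} (hD : IsDeltaDomain r D)
    (hU : IsOpen U) (hdisc : ∀ x : ℂ, ‖x‖ ≤ r → x ≠ r → x ∈ U)
    (hloc : ∀ᶠ x in 𝓝[D] (r : ℂ), x ∈ U) :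
    ∃ D', IsDeltaDomain r D' ∧ D' ⊆ D ∧ D' ⊆ U := by
  obtain ⟨φ, R, h0, h1, hR, rfl⟩ := hD
  rw [eventually_nhdsWithin_iff, Metric.eventually_nhds_iff] at hloc
  obtain ⟨ε, hε, hloc⟩ := hloc
  have hK : IsCompact (Metric.closedBall (0 : ℂ) r ∩ {x : ℂ | ε / 2 ≤ ‖x - r‖}) :=
    (isCompact_closedBall _ _).inter_right (isClosed_le (by fun_prop) (by fun_prop))
  have hKU : Metric.closedBall (0 : ℂ) r ∩ {x : ℂ | ε / 2 ≤ ‖x - r‖} ⊆ U := by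
    rintro x ⟨hx1, hx2⟩
    refine hdisc x (by simpa using hx1) ?_
    rintro rfl
    simp only [Set.mem_ofPred_eq, sub_self, norm_zero] at hx2
    linarith
  obtain ⟨δ, hδ, hsub⟩ := hK.exists_thickening_subset_open hU hKU
  set m := min (min δ (ε / 2)) (R - r) with hm
  have hm0 : 0 < m := lt_min (lt_min hδ (by linarith)) (by linarith)
  have hmδ : m ≤ δ := (min_le_left _ _).trans (min_le_left _ _)
  have hmε : m ≤ ε / 2 := (min_le_left _ _).trans (min_le_right _ _)
  have hmR : m ≤ R - r := min_le_right _ _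
  have hDD : deltaRegion r φ (r + m) ⊆ deltaRegion r φ R := fun x hx =>
    ⟨hx.1.trans_le (by linarith), hx.2⟩
  refine ⟨deltaRegion r φ (r + m), ⟨φ, r + m, h0, h1, by linarith, rfl⟩, hDD, fun x hx => ?_⟩
  by_cases hxr : ‖x‖ ≤ r
  · exact hdisc x hxr hx.2.1
  push Not at hxr
  by_cases hxε : ‖x - r‖ < ε
  · exact hloc (by rwa [dist_eq_norm]) (hDD hx)
  push Not at hxε
  have hx0 : 0 < ‖x‖ := hr.trans hxr
  -- Radial projection onto |y| = r; it moves `x` by less than ε/2, so `y` stays at least ε/2 from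
  -- `r`.
  set y : ℂ := ((r / ‖x‖ : ℝ) : ℂ) * x with hy
  have hxy : ‖x - y‖ = ‖x‖ - r := by
    have : x - y = ((1 - r / ‖x‖ : ℝ) : ℂ) * x := by rw [hy]; push_cast; ring
    rw [this, norm_mul, Complex.norm_real, Real.norm_of_nonneg]
    · field_simp
    · rw [sub_nonneg, div_le_one hx0]; exact hxr.le
  have hxy' : ‖x - y‖ < m := by rw [hxy]; linarith [hx.1]
  refine hsub (Metric.mem_thickening_iff.2 ⟨y, ⟨?_, ?_⟩, ?_⟩)
  · rw [mem_closedBall_zero_iff, hy, norm_mul, Complex.norm_real,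
      Real.norm_of_nonneg (by positivity), div_mul_cancel₀ _ hx0.ne']
  · have := norm_sub_le_norm_sub_add_norm_sub x y (r : ℂ)
    simp only [Set.mem_ofPred_eq]
    linarith
  · rw [dist_eq_norm]; linarith

/-- Near `r`, the discs centred in `‖x‖ < r` of radius proportional to the distance to `r`
stay inside a `Δ`-domain at `r`. -/
theorem IsDeltaDomain.exists_closedBall_subset {r : ℝ} (hr : 0 < r) {D : Set ℂ}
    (hD : IsDeltaDomain r D) :
    ∃ η > 0, η < 1 ∧ ∃ ε > 0, ∀ x : ℂ, ‖x‖ < r → ‖x - r‖ < ε →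
      Metric.closedBall x (η * ‖x - r‖) ⊆ D := by
  obtain ⟨φ, R, h0, h1, hR, rfl⟩ := hD
  have hcos : 0 < Real.cos φ := Real.cos_pos_of_mem_Ioo ⟨by linarith, h1⟩
  have hcos1 := Real.cos_le_one φ
  -- With η = cos φ / 3, Re(y - r) < η|x - r|, whereas |y - r| cos φ ≥ (2/3) cos φ |x - r|.
  refine ⟨Real.cos φ / 3, by positivity, by linarith, R - r, by linarith, fun x hx hxε y hy => ?_⟩
  have hne : x ≠ r := by
    rintro rfl
    rw [Complex.norm_real, Real.norm_of_nonneg hr.le] at hx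
    exact lt_irrefl _ hx
  have hre := re_sub_neg_of_norm_le hr hx.le hne
  have hpos : 0 < ‖x - (r : ℂ)‖ := norm_pos_iff.2 (sub_ne_zero.2 hne)
  rw [Metric.mem_closedBall, dist_eq_norm] at hy
  rw [mem_deltaRegion_iff h0.le (by linarith [Real.pi_pos])]
  constructor
  · have := norm_le_norm_add_norm_sub' y x
    nlinarith
  · have e1 : (y - r).re = (x - r).re + (y - x).re := by simp
    have e2 := (Complex.abs_re_le_norm (y - x))
    have e3 := le_abs_self (y - x).re
    have e4 := norm_sub_le_norm_sub_add_norm_sub x y (r : ℂ)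
    rw [norm_sub_rev x y] at e4
    have e5 : 2 / 3 * ‖x - (r : ℂ)‖ ≤ ‖y - r‖ := by nlinarith
    nlinarith

/-! ### Coefficient bound for the remainder. -/

theorem circleMap_sub_ofReal_norm_comm (r ρ θ : ℝ) :
    ‖circleMap 0 ρ θ - r‖ = ‖circleMap 0 r θ - ρ‖ := by
  have h1 : ∀ s t : ℝ, ‖circleMap 0 s θ - t‖ ^ 2 = s ^ 2 - 2 * s * t * Real.cos θ + t ^ 2 := by
    intro s t
    rw [Complex.sq_norm, Complex.normSq_apply]
    simp [circleMap, Complex.exp_ofReal_mul_I_re, Complex.exp_ofReal_mul_I_im]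
    nlinarith [Real.sin_sq_add_cos_sq θ]
  have := h1 ρ r
  rw [← sq_eq_sq₀ (norm_nonneg _) (norm_nonneg _), h1, h1]
  ring

/-- The Poisson integral of the constant 1, evaluated at the point ρ of the disc of radius r. -/
theorem integral_inv_sq_norm_circleMap_sub {r ρ : ℝ} (h0 : 0 ≤ ρ) (h : ρ < r) :
    (2 * Real.pi)⁻¹ * ∫ θ in (0 : ℝ)..2 * Real.pi, (‖circleMap 0 ρ θ - r‖ ^ 2)⁻¹
      = (r ^ 2 - ρ ^ 2)⁻¹ := by
  have hr : 0 < r := h0.trans_lt h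
  have key := DiffContOnCl.circleAverage_poissonKernel_smul (f := fun _ : ℂ => (1 : ℂ)) (c := 0)
    (R := r) (w := (ρ : ℂ)) diffContOnCl_const (by simpa [abs_of_nonneg h0] using h)
  have hk : ∀ θ, poissonKernel 0 (ρ : ℂ) (circleMap 0 r θ) =
      (r ^ 2 - ρ ^ 2) * (‖circleMap 0 ρ θ - r‖ ^ 2)⁻¹ := by
    intro θ
    rw [poissonKernel_def, circleMap_sub_ofReal_norm_comm r ρ θ]
    simp [div_eq_mul_inv]
  simp only [Real.circleAverage_def, Pi.smul_apply', hk] at key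
  rw [intervalIntegral.integral_smul_const, intervalIntegral.integral_const_mul, smul_smul] at key
  have key' := congrArg Complex.re key
  rw [Complex.smul_re, Complex.one_re, smul_eq_mul, mul_one, mul_left_comm] at key'
  exact eq_inv_of_mul_eq_one_right key'

/-- Cauchy's formula is bounded by the mean over the circle; the maximum would give (r - ρ)⁻², too
weak by a factor of order n. -/
theorem norm_iteratedDeriv_div_factorial_le {G : ℂ → ℂ} {r C : ℝ}
    (hG : AnalyticOnNhd ℂ G (Metric.ball 0 r))
    (hC : ∀ x : ℂ, ‖x‖ < r → ‖G x‖ ≤ C * (‖x - r‖ ^ 2)⁻¹) {ρ : ℝ} (h0 : 0 < ρ) (hρ : ρ < r)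
    (m : ℕ) :
    ‖iteratedDeriv m G 0‖ / m.factorial ≤ C * (r ^ 2 - ρ ^ 2)⁻¹ * (ρ ^ m)⁻¹ := by
  have hsub : Metric.closedBall (0 : ℂ) ρ ⊆ Metric.ball 0 r := Metric.closedBall_subset_ball hρ
  have hd : DiffContOnCl ℂ G (Metric.ball 0 ρ) :=
    DifferentiableOn.diffContOnCl_ball (hG.differentiableOn) hsub
  lift ρ to NNReal using h0.le
  have hp := hd.hasFPowerSeriesOnBall (by exact_mod_cast h0)
  have h1 := hp.factorial_smul 1 m
  have h2 : ‖iteratedDeriv m G 0‖ / m.factorial ≤ ‖cauchyPowerSeries G 0 ρ m‖ := by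
    rw [iteratedDeriv_eq_iteratedFDeriv, ← h1, div_le_iff₀ (by positivity), nsmul_eq_mul, norm_mul,
      mul_comm, Complex.norm_natCast]
    gcongr
    simpa only [norm_one, Finset.prod_const_one, mul_one] using
      (cauchyPowerSeries G 0 ρ m).le_opNorm (fun _ => 1)
  refine h2.trans ((norm_cauchyPowerSeries_le _ _ _ _).trans ?_)
  rw [abs_of_pos h0, inv_pow]
  refine mul_le_mul_of_nonneg_right ?_ (by positivity)
  rw [← integral_inv_sq_norm_circleMap_sub h0.le hρ, mul_left_comm]
  refine mul_le_mul_of_nonneg_left ?_ (by positivity)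
  rw [← intervalIntegral.integral_const_mul]
  have hmem : ∀ θ, circleMap 0 (ρ : ℝ) θ ∈ Metric.ball (0 : ℂ) r := fun θ =>
    hsub (circleMap_mem_closedBall _ h0.le θ)
  have hcirc : Continuous (fun θ => circleMap 0 (ρ : ℝ) θ) := continuous_circleMap _ _
  refine intervalIntegral.integral_mono_on (by positivity) ?_ ?_ ?_
  · refine Continuous.intervalIntegrable ?_ _ _
    exact (hG.continuousOn.comp_continuous hcirc hmem).norm
  · refine Continuous.intervalIntegrable ?_ _ _
    refine continuous_const.mul (Continuous.inv₀ (by fun_prop) fun θ => ?_)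
    have : circleMap 0 (ρ : ℝ) θ ≠ r := by
      intro h
      have := hmem θ
      rw [h, mem_ball_zero_iff, Complex.norm_real] at this
      exact absurd (le_abs_self r) (not_le.2 this)
    exact pow_ne_zero _ (norm_ne_zero_iff.2 (sub_ne_zero.2 this))
  · intro θ _
    exact hC _ (by simpa using hmem θ)

/-- Near `r`, Cauchy's estimate on a disc of radius η|x - r| loses |x - r|³ against g = O(|x - r|);
elsewhere compactness suffices. Order three makes the exponent 2, matching the Poisson kernel. -/
theorem exists_norm_iteratedDeriv_le {r : ℝ} (hr : 0 < r) {D : Set ℂ} (hD : IsDeltaDomain r D)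
    {g : ℂ → ℂ} (hg : AnalyticOnNhd ℂ g D)
    (hO : g =O[𝓝[D] (r : ℂ)] (fun x : ℂ => 1 - x / (r : ℂ))) :
    ∃ C, 0 ≤ C ∧ ∀ x : ℂ, ‖x‖ < r → ‖iteratedDeriv 3 g x‖ ≤ C * (‖x - r‖ ^ 2)⁻¹ := by
  obtain ⟨η, hη, hη1, ε, hε, hball⟩ := hD.exists_closedBall_subset hr
  obtain ⟨A, hA0, hA⟩ := hO.exists_nonneg
  rw [isBigOWith_iff, eventually_nhdsWithin_iff, Metric.eventually_nhds_iff] at hA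
  obtain ⟨ε', hε', hA⟩ := hA
  have hr' : (r : ℂ) ≠ 0 := by exact_mod_cast hr.ne'
  have hone : ∀ y : ℂ, ‖1 - y / r‖ = ‖y - r‖ / r := by
    intro y
    rw [one_sub_div hr', norm_div, Complex.norm_real, Real.norm_of_nonneg hr.le, norm_sub_rev]
  set δ := min ε (ε' / 2) with hδ
  have hδ0 : 0 < δ := lt_min hε (by linarith)
  have hnear : ∀ x : ℂ, ‖x‖ < r → ‖x - r‖ < δ →
      ‖iteratedDeriv 3 g x‖ ≤ (12 * A / (r * η ^ 3)) * (‖x - r‖ ^ 2)⁻¹ := by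
    intro x hx hxδ
    have hne : x ≠ r := by
      rintro rfl
      rw [Complex.norm_real, Real.norm_of_nonneg hr.le] at hx
      exact lt_irrefl _ hx
    have hpos : 0 < ‖x - (r : ℂ)‖ := norm_pos_iff.2 (sub_ne_zero.2 hne)
    have hsub := hball x hx (hxδ.trans_le (min_le_left _ _))
    have hd : DiffContOnCl ℂ g (Metric.ball x (η * ‖x - r‖)) :=
      DifferentiableOn.diffContOnCl_ball hg.differentiableOn hsub
    have := Complex.norm_iteratedDeriv_le_of_forall_mem_sphere_norm_le
      (C := A * (2 * ‖x - r‖ / r)) 3 (by positivity) hd ?_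
    · refine this.trans_eq ?_
      simp only [Nat.factorial]
      push_cast
      field_simp
      ring
    · intro z hz
      have hzx : ‖z - x‖ = η * ‖x - r‖ := by simpa [dist_eq_norm] using hz
      have hzr : ‖z - r‖ ≤ 2 * ‖x - r‖ := by
        have := norm_sub_le_norm_sub_add_norm_sub z x (r : ℂ)
        nlinarith
      have hδε : δ ≤ ε' / 2 := min_le_right _ _
      refine (hA (by rw [dist_eq_norm]; linarith)
        (hsub (Metric.sphere_subset_closedBall hz))).trans ?_
      rw [hone]
      gcongr
  have hK : IsCompact (Metric.closedBall (0 : ℂ) r ∩ {x : ℂ | δ ≤ ‖x - r‖}) :=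
    (isCompact_closedBall _ _).inter_right (isClosed_le (by fun_prop) (by fun_prop))
  have hKD : Metric.closedBall (0 : ℂ) r ∩ {x : ℂ | δ ≤ ‖x - r‖} ⊆ D := by
    rintro x ⟨hx1, hx2⟩
    refine hD.mem_of_norm_le hr (by simpa using hx1) ?_
    rintro rfl
    simp only [Set.mem_ofPred_eq, sub_self, norm_zero] at hx2
    linarith
  have han : AnalyticOnNhd ℂ (iteratedDeriv 3 g) D := by
    rw [iteratedDeriv_eq_iterate]; exact hg.iterated_deriv 3
  obtain ⟨M, hM⟩ := hK.exists_bound_of_continuousOn (han.continuousOn.mono hKD)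
  -- The factor (2r)² absorbs |x - r|⁻², since |x - r| ≤ 2r on the disc.
  refine ⟨max (12 * A / (r * η ^ 3)) (M * (2 * r) ^ 2), le_max_of_le_left (by positivity),
    fun x hx => ?_⟩
  by_cases hxδ : ‖x - r‖ < δ
  · exact (hnear x hx hxδ).trans
      (mul_le_mul_of_nonneg_right (le_max_left _ _) (by positivity))
  push Not at hxδ
  have hMx := hM x ⟨by simpa using hx.le, hxδ⟩
  have hM0 : 0 ≤ M := (norm_nonneg _).trans hMx
  have hpos : 0 < ‖x - (r : ℂ)‖ := hδ0.trans_le hxδ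
  have hle : ‖x - (r : ℂ)‖ ≤ 2 * r := by
    have := norm_sub_le x (r : ℂ)
    rw [Complex.norm_real, Real.norm_of_nonneg hr.le] at this
    linarith
  refine hMx.trans (le_trans ?_
      (mul_le_mul_of_nonneg_right (le_max_right _ _) (by positivity)))
  rw [← div_eq_mul_inv, le_div_iff₀ (by positivity)]
  gcongr

theorem IsDeltaDomain.taylorCoeffZero_isBigO {r : ℝ} (hr : 0 < r) {D : Set ℂ}
    (hD : IsDeltaDomain r D) {g : ℂ → ℂ} (hg : AnalyticOnNhd ℂ g D)
    (hO : g =O[𝓝[D] (r : ℂ)] (fun x : ℂ => 1 - x / (r : ℂ))) :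
    (taylorCoeffZero g) =O[atTop] (fun n : ℕ => (r ^ n)⁻¹ * ((n : ℝ) ^ 2)⁻¹) := by
  obtain ⟨C, hC0, hC⟩ := exists_norm_iteratedDeriv_le hr hD hg hO
  have han : AnalyticOnNhd ℂ (iteratedDeriv 3 g) (Metric.ball 0 r) := by
    rw [iteratedDeriv_eq_iterate]
    refine (hg.iterated_deriv 3).mono fun x hx => hD.mem_of_norm_le hr ?_ ?_
    · simpa using (mem_ball_zero_iff.1 hx).le
    · rintro rfl
      rw [mem_ball_zero_iff, Complex.norm_real, Real.norm_of_nonneg hr.le] at hx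
      exact lt_irrefl _ hx
  refine IsBigO.of_bound (9 * C * r) ?_
  filter_upwards [eventually_ge_atTop 3] with n hn
  obtain ⟨m, rfl⟩ := Nat.exists_eq_add_of_le' hn
  have hm : (0 : ℝ) ≤ m := m.cast_nonneg
  -- This radius costs only (r/ρ)ᵐ ≤ e, while 1/(r² - ρ²) ≤ (m + 2)/r².
  set ρ : ℝ := r * ((m + 1) / (m + 2)) with hρ
  have hρ0 : 0 < ρ := by positivity
  have hρr : ρ < r := by
    rw [hρ]
    refine mul_lt_of_lt_one_right hr ?_
    rw [div_lt_one (by positivity)]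
    linarith
  have key := norm_iteratedDeriv_div_factorial_le han hC hρ0 hρr m
  have h1 : (r ^ 2 - ρ ^ 2)⁻¹ ≤ (m + 2) / r ^ 2 := by
    rw [inv_le_comm₀ (by nlinarith) (by positivity), inv_div]
    have h2 : r ^ 2 / (m + 2) = r * (r - ρ) := by
      rw [hρ]; field_simp; ring
    rw [h2]
    nlinarith
  have h3 : (ρ ^ m)⁻¹ ≤ 3 * (r ^ m)⁻¹ := by
    rw [hρ, mul_pow, mul_inv, mul_comm]
    refine mul_le_mul_of_nonneg_right ?_ (by positivity)
    rw [← inv_pow, inv_div]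
    calc ((m + 2) / (m + 1) : ℝ) ^ m ≤ (Real.exp (1 / (m + 1))) ^ m := by
          gcongr
          have := Real.add_one_le_exp (1 / (m + 1) : ℝ)
          refine le_trans (le_of_eq ?_) this
          field_simp
          ring
      _ = Real.exp (m / (m + 1)) := by rw [← Real.exp_nat_mul]; congr 1; ring
      _ ≤ Real.exp 1 := by
          gcongr
          rw [div_le_one (by positivity)]
          linarith
      _ ≤ 3 := by linarith [Real.exp_one_lt_d9]
  have hit : iteratedDeriv (m + 3) g = iteratedDeriv m (iteratedDeriv 3 g) := by
    simp only [iteratedDeriv_eq_iterate, Function.iterate_add_apply]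
  have hfac : ((m + 3).factorial : ℝ) = (m + 3) * (m + 2) * (m + 1) * m.factorial := by
    simp only [Nat.factorial]; push_cast; ring
  rw [taylorCoeffZero, norm_div, Complex.norm_natCast, hit, hfac]
  have h4 : ‖iteratedDeriv m (iteratedDeriv 3 g) 0‖ / m.factorial
      ≤ C * ((m + 2) / r ^ 2) * (3 * (r ^ m)⁻¹) := by
    refine key.trans ?_
    gcongr
  rw [Real.norm_of_nonneg (by positivity), mul_comm _ (m.factorial : ℝ), ← div_div,
    div_le_iff₀ (by positivity)]
  refine h4.trans ?_
  push_cast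
  have h5 : C * ((m + 2) / r ^ 2) * (3 * (r ^ m)⁻¹)
      = (3 * C * r * (r ^ (m + 3))⁻¹) * (m + 2) := by
    field_simp
    ring
  have h6 : 9 * C * r * ((r ^ (m + 3))⁻¹ * (((m : ℝ) + 3) ^ 2)⁻¹) * ((m + 3) * (m + 2) * (m + 1))
      = (3 * C * r * (r ^ (m + 3))⁻¹) * ((m + 2) * (3 * (m + 1) / (m + 3))) := by
    field_simp
    ring
  rw [h5, h6]
  refine mul_le_mul_of_nonneg_left ?_ (by positivity)
  refine le_mul_of_one_le_right (by positivity) ?_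
  rw [le_div_iff₀ (by positivity)]
  linarith

/-! ### Square-root expansions under composition. -/

theorem tendsto_one_sub_div {r : ℝ} (hr : 0 < r) :
    Tendsto (fun x : ℂ => 1 - x / r) (𝓝 (r : ℂ)) (𝓝 0) := by
  have hr' : (r : ℂ) ≠ 0 := by exact_mod_cast hr.ne'
  have : ContinuousAt (fun x : ℂ => 1 - x / r) r := by fun_prop
  simpa [div_self hr'] using this.tendsto

theorem HasSqrtExpansion.tendsto {r : ℝ} (hr : 0 < r) {D : Set ℂ} {f : ℂ → ℂ} {a c : ℂ}
    (hf : HasSqrtExpansion f r D a c) : Tendsto f (𝓝[D] (r : ℂ)) (𝓝 a) := by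
  have h0 : Tendsto (fun x : ℂ => 1 - x / r) (𝓝[D] (r : ℂ)) (𝓝 0) :=
    (tendsto_one_sub_div hr).mono_left nhdsWithin_le_nhds
  have h1 := hf.trans_tendsto h0
  have h2 : Tendsto (fun x : ℂ => (1 - x / r) ^ (1 / 2 : ℂ)) (𝓝[D] (r : ℂ)) (𝓝 0) := by
    have := (Complex.continuousAt_cpow_const_of_re_pos (z := 0) (w := 1 / 2) (Or.inl (by simp))
      (by norm_num)).tendsto.comp h0
    simpa [Function.comp_def] using this
  have h3 := h1.add (tendsto_const_nhds (x := a) |>.sub (h2.const_mul c))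
  simpa using h3

/-- The linear term in the first variable is left in the error, where it also dominates the square
of that increment. -/
theorem isBigO_analyticAt_prod {Ψ : ℂ × ℂ → ℂ} {p : ℂ × ℂ} (hΨ : AnalyticAt ℂ Ψ p) :
    (fun q : ℂ × ℂ => Ψ q - Ψ p - partialV Ψ p.1 p.2 * (q.2 - p.2)) =O[𝓝 p]
      (fun q => ‖q.1 - p.1‖ + ‖q.2 - p.2‖ ^ 2) := by
  obtain ⟨P, hP⟩ := hΨ
  have h1 := hP.isBigO_sub_partialSum_pow 2
  have hfd := hP.hasFDerivAt
  set L := fderiv ℂ Ψ p with hL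
  have hLP : ∀ y : ℂ × ℂ, P.partialSum 2 y = Ψ p + L y := by
    intro y
    rw [hL, hP.fderiv_eq, FormalMultilinearSeries.partialSum, Finset.sum_range_succ,
      Finset.sum_range_one, hP.coeff_zero]
    rfl
  have hpart : partialV Ψ p.1 p.2 = L (0, 1) := by
    have hc : HasDerivAt (fun w : ℂ => (p.1, w)) (0, 1) p.2 :=
      (hasDerivAt_const _ _).prodMk (hasDerivAt_id _)
    exact (hP.differentiableAt.hasFDerivAt.comp_hasDerivAt p.2 hc).deriv
  have h2 : (fun q : ℂ × ℂ => Ψ q - (Ψ p + L (q - p))) =O[𝓝 p] (fun q => ‖q - p‖ ^ 2) := by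
    have ht : Tendsto (fun q : ℂ × ℂ => q - p) (𝓝 p) (𝓝 0) := by
      have : ContinuousAt (fun q : ℂ × ℂ => q - p) p := by fun_prop
      simpa using this.tendsto
    have := h1.comp_tendsto ht
    simpa [Function.comp_def, hLP] using this
  have h3 : (fun q : ℂ × ℂ => ‖q - p‖ ^ 2) =O[𝓝 p] (fun q => ‖q.1 - p.1‖ + ‖q.2 - p.2‖ ^ 2) := by
    refine IsBigO.of_bound 1 ?_
    have hlt : ∀ᶠ q : ℂ × ℂ in 𝓝 p, ‖q.1 - p.1‖ < 1 := by
      have : ContinuousAt (fun q : ℂ × ℂ => ‖q.1 - p.1‖) p := by fun_prop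
      exact this.eventually_lt continuousAt_const (by simp)
    filter_upwards [hlt] with q hq
    rw [one_mul, Real.norm_of_nonneg (by positivity), Real.norm_of_nonneg (by positivity),
      Prod.norm_def, Prod.fst_sub, Prod.snd_sub]
    rcases max_choice ‖q.1 - p.1‖ ‖q.2 - p.2‖ with h | h <;> rw [h] <;>
      nlinarith [norm_nonneg (q.1 - p.1), sq_nonneg ‖q.2 - p.2‖]
  have h4 : (fun q : ℂ × ℂ => L (q.1 - p.1, 0)) =O[𝓝 p]
      (fun q => ‖q.1 - p.1‖ + ‖q.2 - p.2‖ ^ 2) := by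
    refine IsBigO.of_bound ‖L‖ (Eventually.of_forall fun q => ?_)
    refine (L.le_opNorm _).trans ?_
    refine mul_le_mul_of_nonneg_left ?_ (norm_nonneg _)
    rw [Real.norm_of_nonneg (by positivity), Prod.norm_def]
    simp
  refine ((h2.trans h3).add h4).congr_left fun q => ?_
  have hsplit : L (q - p) = L (q.1 - p.1, 0) + (q.2 - p.2) * L (0, 1) := by
    have : q - p = (q.1 - p.1, 0) + (q.2 - p.2) • ((0, 1) : ℂ × ℂ) := by
      ext <;> simp
    rw [this, map_add, map_smul, smul_eq_mul]
  rw [hsplit, hpart]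
  ring

theorem HasSqrtExpansion.sub_isBigO {r : ℝ} (hr : 0 < r) {D : Set ℂ} {f : ℂ → ℂ} {a c : ℂ}
    (hf : HasSqrtExpansion f r D a c) :
    (fun x => ‖f x - a‖ ^ 2) =O[𝓝[D] (r : ℂ)] (fun x : ℂ => 1 - x / (r : ℂ)) := by
  have hsq : ∀ x : ℂ, ‖(1 - x / r) ^ (1 / 2 : ℂ)‖ ^ 2 = ‖1 - x / r‖ := by
    intro x
    rw [← norm_pow, ← Complex.cpow_nat_mul]
    norm_num
  have h1 : (fun x : ℂ => 1 - x / (r : ℂ)) =O[𝓝[D] (r : ℂ)]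
      fun x => (1 - x / r) ^ (1 / 2 : ℂ) := by
    refine IsBigO.of_bound 1 ?_
    have hlt : ∀ᶠ x : ℂ in 𝓝[D] (r : ℂ), ‖1 - x / r‖ < 1 := by
      have := (tendsto_one_sub_div hr).norm.mono_left (nhdsWithin_le_nhds (s := D))
      rw [norm_zero] at this
      exact this.eventually_lt_const one_pos
    filter_upwards [hlt] with x hx
    rw [one_mul, ← hsq]
    rw [← hsq] at hx
    have := norm_nonneg ((1 - x / r) ^ (1 / 2 : ℂ))
    nlinarith [sq_nonneg (‖(1 - x / r) ^ (1 / 2 : ℂ)‖ - 1)]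
  have h2 : (fun x => f x - a) =O[𝓝[D] (r : ℂ)] fun x => (1 - x / r) ^ (1 / 2 : ℂ) := by
    have h3 : (fun x : ℂ => c * (1 - x / r) ^ (1 / 2 : ℂ)) =O[𝓝[D] (r : ℂ)]
        fun x => (1 - x / r) ^ (1 / 2 : ℂ) := (isBigO_refl _ _).const_mul_left c
    exact ((hf.trans h1).sub h3).congr_left fun x => by ring
  refine (h2.norm_norm.pow 2).trans (IsBigO.of_bound 1 (Eventually.of_forall fun x => ?_))
  rw [hsq, one_mul, norm_norm]

theorem HasSqrtExpansion.comp_analyticAt {r : ℝ} (hr : 0 < r) {D : Set ℂ} {f : ℂ → ℂ} {a c : ℂ}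
    (hf : HasSqrtExpansion f r D a c) {Ψ : ℂ × ℂ → ℂ} (hΨ : AnalyticAt ℂ Ψ ((r : ℂ), a)) :
    HasSqrtExpansion (fun x => Ψ (x, f x)) r D (Ψ ((r : ℂ), a)) (c * partialV Ψ r a) := by
  have hr' : (r : ℂ) ≠ 0 := by exact_mod_cast hr.ne'
  have ht : Tendsto (fun x => (x, f x)) (𝓝[D] (r : ℂ)) (𝓝 ((r : ℂ), a)) :=
    (tendsto_id.mono_left nhdsWithin_le_nhds).prodMk_nhds (hf.tendsto hr)
  have h1 := (isBigO_analyticAt_prod hΨ).comp_tendsto ht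
  have hx : (fun x : ℂ => ‖x - r‖) =O[𝓝[D] (r : ℂ)] (fun x : ℂ => 1 - x / (r : ℂ)) := by
    refine IsBigO.of_bound r (Eventually.of_forall fun x => ?_)
    rw [one_sub_div hr', norm_div, Complex.norm_real, Real.norm_of_nonneg hr.le, norm_norm,
      norm_sub_rev, mul_div_cancel₀ _ hr.ne']
  have h2 := h1.trans (hx.add (hf.sub_isBigO hr))
  have h3 := IsBigO.const_mul_left hf (partialV Ψ r a)
  refine (h2.add h3).congr_left fun x => ?_
  simp only [Function.comp_apply]
  ring

/-! ### Coefficients of the square root, and transfer. -/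

theorem iteratedDeriv_sqrt_one_sub_div {r : ℝ} (hr : 0 < r) (n : ℕ) : ∀ x : ℂ, ‖x‖ < r →
    iteratedDeriv n (fun x : ℂ => (1 - x / r) ^ (1 / 2 : ℂ)) x =
      (∏ j ∈ Finset.range n, ((j : ℂ) - 1 / 2)) * ((r : ℂ) ^ n)⁻¹
        * (1 - x / r) ^ ((1 / 2 : ℂ) - n) := by
  have hr' : (r : ℂ) ≠ 0 := by exact_mod_cast hr.ne'
  induction n with
  | zero => intro x _; simp
  | succ n ih =>
    intro x hx
    have hev : iteratedDeriv n (fun x : ℂ => (1 - x / r) ^ (1 / 2 : ℂ)) =ᶠ[𝓝 x] fun x =>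
        (∏ j ∈ Finset.range n, ((j : ℂ) - 1 / 2)) * ((r : ℂ) ^ n)⁻¹
          * (1 - x / r) ^ ((1 / 2 : ℂ) - n) := by
      filter_upwards [(isOpen_lt continuous_norm continuous_const).mem_nhds hx] with y hy
      exact ih y hy
    have hs : 1 - x / r ∈ Complex.slitPlane := by
      refine Complex.mem_slitPlane_of_norm_lt_one (z := -(x / r)) ?_
      rw [norm_neg, norm_div, Complex.norm_real, Real.norm_of_nonneg hr.le, div_lt_one hr]
      exact hx
    have hd : HasDerivAt (fun x : ℂ => 1 - x / r) (-(1 / r)) x := by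
      simpa using ((hasDerivAt_id x).div_const (r : ℂ)).const_sub 1
    have := ((hd.cpow_const (c := (1 / 2 : ℂ) - n) hs).const_mul
      ((∏ j ∈ Finset.range n, ((j : ℂ) - 1 / 2)) * ((r : ℂ) ^ n)⁻¹)).deriv
    rw [iteratedDeriv_succ, hev.deriv_eq, this, Finset.prod_range_succ]
    have he : (1 / 2 : ℂ) - n - 1 = 1 / 2 - ((n + 1 : ℕ) : ℂ) := by push_cast; ring
    rw [he]
    field_simp
    ring_nf

theorem taylorCoeffZero_sqrt_one_sub_div {r : ℝ} (hr : 0 < r) (n : ℕ) :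
    taylorCoeffZero (fun x : ℂ => (1 - x / r) ^ (1 / 2 : ℂ)) n =
      (((r ^ n)⁻¹ * ((∏ j ∈ Finset.range n, ((j : ℝ) - 1 / 2)) / n.factorial) : ℝ) : ℂ) := by
  rw [taylorCoeffZero, iteratedDeriv_sqrt_one_sub_div hr n 0 (by simpa using hr)]
  push_cast
  rw [zero_div, sub_zero, Complex.one_cpow]
  ring

theorem Real.Gamma_neg_one_half : Real.Gamma (-(1 / 2)) = -(2 * Real.sqrt Real.pi) := by
  have h := Real.Gamma_add_one (s := -(1 / 2)) (by norm_num)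
  have h2 : (-(1 / 2) + 1 : ℝ) = 1 / 2 := by norm_num
  rw [h2, Real.Gamma_one_half_eq] at h
  linarith

/-- The product is the denominator of `Real.GammaSeq` at -1/2 without its last factor n - 1/2, hence
the correction n/(n - 1/2) → 1. -/
theorem prod_sub_half_div_factorial_isEquivalent :
    (fun n : ℕ => (∏ j ∈ Finset.range n, ((j : ℝ) - 1 / 2)) / n.factorial) ~[atTop]
      (fun n : ℕ => -(1 / (2 * Real.sqrt Real.pi)) * (n : ℝ) ^ (-(3 / 2) : ℝ)) := by
  have hG := Real.GammaSeq_tendsto_Gamma (-(1 / 2))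
  rw [Real.Gamma_neg_one_half] at hG
  have hne : -(2 * Real.sqrt Real.pi) ≠ 0 := by
    have := Real.sqrt_pos.2 Real.pi_pos
    linarith
  have hquot : Tendsto (fun n : ℕ => (n : ℝ) / (n - 1 / 2)) atTop (𝓝 1) := by
    have h1 : Tendsto (fun n : ℕ => (1 - (1 / 2) * (n : ℝ)⁻¹)⁻¹) atTop (𝓝 1) := by
      have := ((tendsto_inv_atTop_nhds_zero_nat (𝕜 := ℝ)).const_mul (1 / 2)).const_sub 1
      simpa using this.inv₀ (by simp)
    refine h1.congr' ?_
    filter_upwards [eventually_ge_atTop 1] with n hn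
    have : (1 : ℝ) ≤ n := by exact_mod_cast hn
    have h3 : (n : ℝ) - 1 / 2 ≠ 0 := by linarith
    have h4 : (1 : ℝ) - 1 / 2 * (n : ℝ)⁻¹ = (n - 1 / 2) / n := by field_simp
    rw [h4, inv_div]
  refine (isEquivalent_iff_tendsto_one ?_).2 ?_
  · filter_upwards [eventually_ge_atTop 1] with n hn
    have : (0 : ℝ) < n := by exact_mod_cast hn
    have h1 : (n : ℝ) ^ (-(3 / 2) : ℝ) ≠ 0 := (Real.rpow_pos_of_pos this _).ne'
    have h2 := Real.sqrt_pos.2 Real.pi_pos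
    exact mul_ne_zero (neg_ne_zero.2 (by positivity)) h1
  · have := (hquot.mul (hG.inv₀ hne)).mul_const (-(2 * Real.sqrt Real.pi))
    rw [one_mul, inv_mul_cancel₀ hne] at this
    refine this.congr' ?_
    filter_upwards [eventually_ge_atTop 1] with n hn
    have hn1 : (1 : ℝ) ≤ n := by exact_mod_cast hn
    have hn0 : (0 : ℝ) < n := by linarith
    have h2 := Real.sqrt_pos.2 Real.pi_pos
    have hprod : ∏ j ∈ Finset.range n, ((j : ℝ) - 1 / 2) ≠ 0 := by
      refine Finset.prod_ne_zero_iff.2 fun j _ h => ?_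
      have h3 : ((2 * j : ℕ) : ℝ) = (1 : ℕ) := by push_cast; linarith
      have h4 : 2 * j = 1 := by exact_mod_cast h3
      omega
    have h3 : (n : ℝ) - 1 / 2 ≠ 0 := by linarith
    have hrp : (n : ℝ) ^ (-(3 / 2) : ℝ) = (n : ℝ) ^ (-(1 / 2) : ℝ) * (n : ℝ)⁻¹ := by
      rw [← Real.rpow_neg_one, ← Real.rpow_add hn0]; norm_num
    have hpr : ∏ j ∈ Finset.range (n + 1), (-(1 / 2) + (j : ℝ)) =
        (∏ j ∈ Finset.range n, ((j : ℝ) - 1 / 2)) * (n - 1 / 2) := by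
      rw [← Finset.prod_range_succ (fun j : ℕ => (j : ℝ) - 1 / 2)]
      exact Finset.prod_congr rfl fun j _ => by ring
    have hp := (Real.rpow_pos_of_pos hn0 (-(1 / 2))).ne'
    have hf : (n.factorial : ℝ) ≠ 0 := by positivity
    simp only [Pi.div_apply, Real.GammaSeq]
    rw [hrp, hpr]
    generalize ∏ j ∈ Finset.range n, ((j : ℝ) - 1 / 2) = Q at hprod ⊢
    generalize (n : ℝ) - 1 / 2 = u at h3 ⊢
    field_simp

/-- Singularity analysis for a square-root singularity. -/
theorem IsDeltaDomain.taylorCoeffZero_isEquivalent {r : ℝ} (hr : 0 < r) {D : Set ℂ}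
    (hD : IsDeltaDomain r D) {f : ℂ → ℂ} (hf : AnalyticOnNhd ℂ f D) {a c : ℂ} (hc : c ≠ 0)
    (hexp : HasSqrtExpansion f r D a c) :
    (fun n : ℕ => taylorCoeffZero f n) ~[atTop]
        (fun n : ℕ => c / (2 * (Real.sqrt Real.pi : ℂ)) *
          (((r ^ n)⁻¹ * (n : ℝ) ^ (-(3 / 2) : ℝ) : ℝ) : ℂ)) := by
  set s : ℂ → ℂ := fun x => (1 - x / r) ^ (1 / 2 : ℂ) with hs
  set g : ℂ → ℂ := fun x => f x - (a - c * s x) with hg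
  have hsan : AnalyticOnNhd ℂ s D := fun x hx =>
    AnalyticAt.cpow (by fun_prop) analyticAt_const (hD.one_sub_div_mem_slitPlane hr hx)
  have hgan : AnalyticOnNhd ℂ g D :=
    hf.sub (analyticOnNhd_const.sub (analyticOnNhd_const.mul hsan))
  have hgO := hD.taylorCoeffZero_isBigO hr hgan hexp
  have h0 := hD.zero_mem hr
  -- The constant `a` contributes only at n = 0.
  have hcoeff : ∀ n, 1 ≤ n →
      taylorCoeffZero f n = -c * taylorCoeffZero s n + taylorCoeffZero g n := by
    intro n hn
    have hfe : f = fun x => (a + -c * s x) + g x := by funext x; simp only [hg]; ring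
    have h1 : ContDiffAt ℂ n s 0 := (hsan 0 h0).contDiffAt
    have h2 : ContDiffAt ℂ n g 0 := (hgan 0 h0).contDiffAt
    have h3 : iteratedDeriv n f 0 = -c * iteratedDeriv n s 0 + iteratedDeriv n g 0 := by
      conv_lhs => rw [hfe]
      rw [iteratedDeriv_fun_add (contDiffAt_const.add (contDiffAt_const.mul h1)) h2,
        iteratedDeriv_const_add (by omega), iteratedDeriv_const_mul_field]
    rw [taylorCoeffZero, h3, taylorCoeffZero, taylorCoeffZero]
    ring
  have hπ : ((Real.sqrt Real.pi : ℝ) : ℂ) ≠ 0 := by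
    exact_mod_cast (Real.sqrt_pos.2 Real.pi_pos).ne'
  have hmain : (fun n => -c * taylorCoeffZero s n) ~[atTop]
      (fun n : ℕ => c / (2 * (Real.sqrt Real.pi : ℂ)) *
          (((r ^ n)⁻¹ * (n : ℝ) ^ (-(3 / 2) : ℝ) : ℝ) : ℂ)) := by
    have h1 := (IsEquivalent.refl (u := fun n : ℕ => (r ^ n)⁻¹) (l := atTop)).mul
      prod_sub_half_div_factorial_isEquivalent
    have h2 : (fun n : ℕ => taylorCoeffZero s n) ~[atTop] fun n : ℕ =>
        (((r ^ n)⁻¹ * (-(1 / (2 * Real.sqrt Real.pi)) * (n : ℝ) ^ (-(3 / 2) : ℝ)) : ℝ) : ℂ) := by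
      simp only [hs, taylorCoeffZero_sqrt_one_sub_div hr]
      rw [IsEquivalent, ← isLittleO_norm_norm] at h1 ⊢
      refine h1.congr (fun n => ?_) (fun n => ?_)
      · simp only [Pi.sub_apply, Pi.mul_apply, ← Complex.ofReal_sub, Complex.norm_real]
      · simp only [Pi.mul_apply, Complex.norm_real]
    have h3 := (IsEquivalent.refl (u := fun _ : ℕ => -c) (l := atTop)).mul h2
    refine h3.congr_right (Eventually.of_forall fun n => ?_)
    simp only [Pi.mul_apply]
    push_cast
    field_simp
  have hlittle : (taylorCoeffZero g) =o[atTop]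
      (fun n : ℕ => c / (2 * (Real.sqrt Real.pi : ℂ)) *
          (((r ^ n)⁻¹ * (n : ℝ) ^ (-(3 / 2) : ℝ) : ℝ) : ℂ)) := by
    have hC : c / (2 * (Real.sqrt Real.pi : ℂ)) ≠ 0 := div_ne_zero hc (mul_ne_zero two_ne_zero hπ)
    refine IsLittleO.const_mul_right hC ?_
    rw [← isLittleO_norm_right]
    simp only [Complex.norm_real]
    rw [isLittleO_norm_right]
    refine hgO.trans_isLittleO ((isBigO_refl _ _).mul_isLittleO ?_)
    have hp : (fun x : ℝ => x ^ (-2 : ℝ)) =o[atTop] fun x : ℝ => x ^ (-(3 / 2) : ℝ) := by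
      refine (isLittleO_iff_tendsto' ?_).2 ?_
      · filter_upwards [eventually_gt_atTop 0] with x hx h
        exact absurd h (Real.rpow_pos_of_pos hx _).ne'
      · refine (tendsto_rpow_neg_atTop (y := 1 / 2) (by norm_num)).congr' ?_
        filter_upwards [eventually_gt_atTop 0] with x hx
        rw [← Real.rpow_sub hx]
        norm_num
    refine (hp.comp_tendsto tendsto_natCast_atTop_atTop).congr_left fun n => ?_
    simp only [Function.comp_apply]
    rw [Real.rpow_neg (Nat.cast_nonneg n)]
    norm_num
  refine (hmain.add_isLittleO hlittle).congr_left ?_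
  filter_upwards [eventually_ge_atTop 1] with n hn
  exact (hcoeff n hn).symm

/-! ### The iteration. -/

theorem mainTheorem9
    (r : ℝ) (hr : 0 < r) (K : ℕ)
    (Ψ : ℂ × ℂ → ℂ) (H : ℕ → ℂ → ℂ) (a : ℕ → ℂ) (c₀ : ℂ) (hc₀ : c₀ ≠ 0)
    (D : Set ℂ) (hD : IsDeltaDomain r D)
    -- `H₀` is analytic in the `Δ`-domain `D` and has a square-root expansion at `r`
    (hH₀ : AnalyticOnNhd ℂ (H 0) D)
    (hexp : HasSqrtExpansion (H 0) r D (a 0) c₀)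
    -- `Ψ` is analytic in a neighbourhood of the points `(r, a_k)`
    (hΨ : AnalyticOnNhd ℂ Ψ {p : ℂ × ℂ | ∃ k ≤ K, p = ((r : ℂ), a k)})
    (ha : ∀ k < K, a (k + 1) = Ψ ((r : ℂ), a k))
    (hdΨ : ∀ k < K, partialV Ψ (r : ℂ) (a k) ≠ 0)
    (hH : ∀ k < K, ∀ x ∈ D, H (k + 1) x = Ψ (x, H k x))
    -- the compositions `Ψ (x, H_k x)` make sense on the closed disc: `Ψ` is a holomorphic
    -- function near each point `(x, H_k x)` with `|x| ≤ r`, `x ≠ r`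
    (hcomp : ∀ k < K, ∀ x : ℂ, ‖x‖ ≤ r → x ≠ (r : ℂ) → AnalyticAt ℂ Ψ (x, H k x)) :
    ∃ c : ℕ → ℂ, c 0 = c₀ ∧
      (∀ k < K, c (k + 1) = c k * partialV Ψ (r : ℂ) (a k)) ∧
      (∀ k, 1 ≤ k → k ≤ K →
        c k = c₀ * ∏ j ∈ Finset.range k, partialV Ψ (r : ℂ) (a j) ∧ c k ≠ 0) ∧
      (∀ k ≤ K, ∃ D' : Set ℂ, IsDeltaDomain r D' ∧ D' ⊆ D ∧
        AnalyticOnNhd ℂ (H k) D' ∧ HasSqrtExpansion (H k) r D' (a k) (c k)) ∧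
      (∀ k ≤ K, (fun n : ℕ => taylorCoeffZero (H k) n) ~[atTop]
        (fun n : ℕ => c k / (2 * (Real.sqrt Real.pi : ℂ)) *
          (((r ^ n)⁻¹ * (n : ℝ) ^ (-(3 / 2) : ℝ) : ℝ) : ℂ))) := by
  set c : ℕ → ℂ := fun k => c₀ * ∏ j ∈ Finset.range k, partialV Ψ (r : ℂ) (a j) with hcdef
  have hc0 : c 0 = c₀ := by simp [hcdef]
  have hcs : ∀ k, c (k + 1) = c k * partialV Ψ (r : ℂ) (a k) := fun k => by
    simp only [hcdef, Finset.prod_range_succ, mul_assoc]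
  have hcne : ∀ k ≤ K, c k ≠ 0 := fun k hk =>
    mul_ne_zero hc₀ (Finset.prod_ne_zero_iff.2 fun j hj =>
      hdΨ j ((Finset.mem_range.1 hj).trans_le hk))
  have hdom : ∀ k ≤ K, ∃ D' : Set ℂ, IsDeltaDomain r D' ∧ D' ⊆ D ∧
      AnalyticOnNhd ℂ (H k) D' ∧ HasSqrtExpansion (H k) r D' (a k) (c k) := by
    intro k
    induction k with
    | zero => exact fun _ => ⟨D, hD, subset_rfl, hH₀, hc0.symm ▸ hexp⟩
    | succ k ih =>
      intro hk
      obtain ⟨E, hE, hED, hEan, hEexp⟩ := ih (by omega)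
      have hpt : AnalyticAt ℂ Ψ ((r : ℂ), a k) := hΨ _ ⟨k, by omega, rfl⟩
      have hcont : ContinuousOn (fun x => (x, H k x)) E := continuousOn_id.prodMk hEan.continuousOn
      -- Points of analyticity form an open set, and `H k` is known to be continuous on `E`.
      have hU : IsOpen (E ∩ (fun x => (x, H k x)) ⁻¹' {p | AnalyticAt ℂ Ψ p}) :=
        hcont.isOpen_inter_preimage hE.isOpen (isOpen_analyticAt ℂ Ψ)
      have hlim : Tendsto (fun x => (x, H k x)) (𝓝[E] (r : ℂ)) (𝓝 ((r : ℂ), a k)) :=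
        (tendsto_id.mono_left nhdsWithin_le_nhds).prodMk_nhds (hEexp.tendsto hr)
      obtain ⟨D', hD', hD'E, hD'U⟩ := hE.exists_subset hr hU
        (fun x hx hne => ⟨hE.mem_of_norm_le hr hx hne, hcomp k (by omega) x hx hne⟩)
        (eventually_mem_nhdsWithin.and (hlim.eventually hpt.eventually_analyticAt))
      refine ⟨D', hD', hD'E.trans hED, fun x hx => ?_, ?_⟩
      · have han : AnalyticAt ℂ (fun x => Ψ (x, H k x)) x :=
          AnalyticAt.comp (hD'U hx).2 (analyticAt_id.prod (hEan x (hD'E hx)))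
        -- The recurrence is given only on `D`; openness of `D` turns it into an equality of germs.
        refine han.congr ?_
        filter_upwards [hD.isOpen.mem_nhds (hED (hD'E hx))] with y hy
        exact (hH k (by omega) y hy).symm
      · have h1 : HasSqrtExpansion (fun x => Ψ (x, H k x)) r D' (a (k + 1)) (c (k + 1)) := by
          rw [hcs, ha k (by omega)]
          exact HasSqrtExpansion.comp_analyticAt hr (IsBigO.mono hEexp (nhdsWithin_mono _ hD'E)) hpt
        refine IsBigO.congr' h1 ?_ EventuallyEq.rfl
        filter_upwards [self_mem_nhdsWithin] with x hx
        rw [hH k (by omega) x (hED (hD'E hx))]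
  refine ⟨c, hc0, fun k _ => hcs k, fun k _ hk => ⟨rfl, hcne k hk⟩, hdom, fun k hk => ?_⟩
  obtain ⟨D', hD', -, han, hex⟩ := hdom k hk
  exact hD'.taylorCoeffZero_isEquivalent hr han (hcne k hk) hex
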